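/- Let $\psi=\Gamma'/\Gamma$ be the digamma function and let $\zeta^{(n)}$ denote the $n$-th derivative of the Riemann zeta function. For every integer $n\ge 1$ and every complex $s$ with $0<\operatorname{Re}(s)<1$ (in particular for every real $s$ with $0<s<1$), $$\zeta^{(n)}(s)=\frac1\pi\sum_{k=0}^n\binom nk\pi^k\sin\!\left(\pi s+\frac{k\pi}2\right)\int_0^\infty\left[\log u-\psi(1+u)+\frac1{2(1+u)}\right]\frac{(-1)^{n-k}\log^{n-k}u}{u^s}\,du ,$$ where all the integrals converge absolutely. Likewise, at $s=0$, for every integer $n\ge1$, $$\zeta^{(n)}(0)=\frac1\pi\sum_{k=0}^n\binom nk\pi^k\sin\!\left(\frac{k\pi}2\right)\int_0^\infty\left[\log u-\psi(1+u)+\frac1{2(1+u)}\right](-1)^{n-k}\log^{n-k}u\,du ,$$ again with absolutely convergent integrals. In particular, $$\zeta''(0)=2\int_0^\infty\left[\psi(1+u)-\log u-\frac1{2(1+u)}\right]\log u\,du .$$ -/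

import Mathlib

open MeasureTheory

noncomputable section

/-- The kernel `log u - ψ(1 + u) + 1 / (2 (1 + u))`, where `ψ` is the digamma function
(used for real `u > 0`; regarded as a complex number). -/
def digammaKernel (u : ℝ) : ℂ :=
  (Real.log u : ℂ) - Complex.digamma (1 + (u : ℂ)) + 1 / (2 * (1 + (u : ℂ)))

/-- The integrand `[log u - ψ(1 + u) + 1 / (2 (1 + u))] (-1)^m (log u)^m / u^s`. -/
def digammaIntegrand (m : ℕ) (s : ℂ) (u : ℝ) : ℂ :=
  digammaKernel u * ((-1) ^ m * (Real.log u : ℂ) ^ m / (u : ℂ) ^ s)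

end

/-! Write `K` for the kernel. Everything follows from `ζ(s) = -1/2 + (1/π) sin(πs) ∫ K(u) u^(-s) du`
on `-1 < Re s < 1` (`riemannZeta_eq_mellin_digammaKernel`): differentiating `n ≥ 1` times by Leibniz
kills the constant, shifts the sine by `kπ/2`, and puts powers of `-log u` under the integral.

For `0 < Re s < 1` the formula comes from the defect `ψ(1+u) - log u`. Iterating `ψ(x+1) = ψ(x) +
1/x` makes it the limit of `log(u+N) - log u - ∑_{k=1}^{N} 1/(u+k)`, whose Mellin transform at `z =
1 - s` is `π / sin(πz)` times `N^z/z - ∑_{k=1}^{N} k^(z-1)`. That factor tends to `-ζ(1-z)`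
(`tendsto_cpow_sub_sum_cpow`), and dominated convergence gives `mellin_digammaDefect`.

The term `1/(2(1+u))` cancels the leading `1/(2u)` of the defect, so `K = O(u^(-2))`
(`abs_realKernel_le`). With at most a logarithmic singularity at `0`, its Mellin transform is
holomorphic on `0 < Re z < 2`; the identity theorem then carries the formula to `-1 < Re s < 1`, in
particular to `s = 0`. -/

/-! ### Zeta as a limit of corrected partial sums, for `Re s > 0` -/

lemma norm_cpow_neg_sub_le {s : ℂ} (hs : 0 < s.re) {a x : ℝ} (ha : 0 < a)
    (hx : x ∈ Set.Icc a (a + 1)) :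
    ‖((a + 1 : ℝ) : ℂ) ^ (-s) - (x : ℂ) ^ (-s)‖ ≤ ‖s‖ * a ^ (-s.re - 1) := by
  have hs0 : -s ≠ 0 := by
    intro h; rw [neg_eq_zero] at h; simp [h] at hs
  have hd : ∀ y ∈ Set.Icc a (a + 1), HasDerivWithinAt (fun y : ℝ => (y : ℂ) ^ (-s))
      (-s * (y : ℂ) ^ (-s - 1)) (Set.Icc a (a + 1)) y := fun y hy =>
    (hasDerivAt_ofReal_cpow_const (ha.trans_le hy.1).ne' hs0).hasDerivWithinAt
  have hb : ∀ y ∈ Set.Icc a (a + 1), ‖-s * (y : ℂ) ^ (-s - 1)‖ ≤ ‖s‖ * a ^ (-s.re - 1) := by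
    intro y hy
    rw [norm_mul, norm_neg, Complex.norm_cpow_eq_rpow_re_of_pos (ha.trans_le hy.1)]
    gcongr
    simp only [Complex.sub_re, Complex.neg_re, Complex.one_re]
    exact Real.rpow_le_rpow_of_nonpos ha hy.1 (by linarith)
  have := (convex_Icc a (a + 1)).norm_image_sub_le_of_norm_hasDerivWithin_le hd hb
    hx (Set.right_mem_Icc.2 (by linarith))
  refine this.trans (mul_le_of_le_one_right (by positivity) ?_)
  rw [Real.norm_eq_abs, abs_le]; constructor <;> linarith [hx.1, hx.2]

/-- The summands of a series for `(s - 1) ζ(s) - s` that converges for `0 < re s`. -/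
noncomputable def zetaSummand (k : ℕ) (s : ℂ) : ℂ :=
  ((k + 2 : ℝ) : ℂ) ^ (1 - s) - ((k + 1 : ℝ) : ℂ) ^ (1 - s)
    - (1 - s) * ((k + 2 : ℝ) : ℂ) ^ (-s)

/-- The summand is a first-order Taylor remainder of `y^(1-s)` at `k + 2`: subtracting the tangent
slope leaves a derivative of size `a^(-Re s - 1)`, which is summable for every `Re s > 0`. -/
lemma norm_zetaSummand_le (k : ℕ) {s : ℂ} (hs : 0 < s.re) :
    ‖zetaSummand k s‖ ≤ ‖1 - s‖ * ‖s‖ * ((k : ℝ) + 1) ^ (-s.re - 1) := by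
  -- The derivative rule for `y^(1-s)` used below needs a nonzero exponent.
  rcases eq_or_ne s 1 with rfl | hs1
  · simp [zetaSummand]
  have hs1' : 1 - s ≠ 0 := sub_ne_zero.2 hs1.symm
  set a : ℝ := (k : ℝ) + 1 with ha_def
  have ha : 0 < a := by positivity
  have h2 : ((k : ℝ) + 2) = a + 1 := by rw [ha_def]; ring
  have hd : ∀ y ∈ Set.Icc a (a + 1), HasDerivWithinAt
      (fun y : ℝ => (y : ℂ) ^ (1 - s) - (1 - s) * ((a + 1 : ℝ) : ℂ) ^ (-s) * (y : ℂ))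
      ((1 - s) * (y : ℂ) ^ (1 - s - 1) - (1 - s) * ((a + 1 : ℝ) : ℂ) ^ (-s) * 1)
      (Set.Icc a (a + 1)) y := fun y hy =>
    ((hasDerivAt_ofReal_cpow_const (ha.trans_le hy.1).ne' hs1').sub
      ((Complex.ofRealCLM.hasDerivAt (x := y)).const_mul _)).hasDerivWithinAt
  have hb : ∀ y ∈ Set.Icc a (a + 1), ‖(1 - s) * (y : ℂ) ^ (1 - s - 1)
      - (1 - s) * ((a + 1 : ℝ) : ℂ) ^ (-s) * 1‖ ≤ ‖1 - s‖ * (‖s‖ * a ^ (-s.re - 1)) := by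
    intro y hy
    have : (1 - s) * (y : ℂ) ^ (1 - s - 1) - (1 - s) * ((a + 1 : ℝ) : ℂ) ^ (-s) * 1
        = -((1 - s) * (((a + 1 : ℝ) : ℂ) ^ (-s) - (y : ℂ) ^ (-s))) := by
      rw [show 1 - s - 1 = -s by ring]; ring
    rw [this, norm_neg, norm_mul]
    gcongr
    exact norm_cpow_neg_sub_le hs ha hy
  have := (convex_Icc a (a + 1)).norm_image_sub_le_of_norm_hasDerivWithin_le hd hb
    (Set.left_mem_Icc.2 (by linarith)) (Set.right_mem_Icc.2 (by linarith))
  rw [zetaSummand, h2, ← ha_def, mul_assoc]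
  refine le_trans (le_of_eq ?_) (this.trans (le_of_eq ?_))
  · congr 1
    push_cast
    ring
  · simp

lemma summable_nat_add_one_rpow {ε : ℝ} (hε : 0 < ε) :
    Summable fun k : ℕ => ((k : ℝ) + 1) ^ (-ε - 1) := by
  have := (summable_nat_add_iff 1).2 (Real.summable_nat_rpow.2 (by linarith : -ε - 1 < -1))
  simpa using this

/-- Telescoping. The Dirichlet sum on the right includes the extra term `1`, so the constant is `-1
+ (1 - s) = -s`. -/
lemma sum_zetaSummand (s : ℂ) (N : ℕ) :
    ∑ k ∈ Finset.range N, zetaSummand k s =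
      ((N + 1 : ℝ) : ℂ) ^ (1 - s)
        - (1 - s) * ∑ k ∈ Finset.range (N + 1), ((k + 1 : ℝ) : ℂ) ^ (-s) - s := by
  induction N with
  | zero => simp
  | succ N ih =>
    rw [Finset.sum_range_succ, ih, Finset.sum_range_succ _ (N + 1), zetaSummand]
    push_cast
    ring_nf

lemma hasSum_zetaSummand_of_one_lt_re {s : ℂ} (hs : 1 < s.re) :
    HasSum (fun k => zetaSummand k s) (riemannZeta₁ s - s) := by
  have hs0 : 0 < s.re := by linarith
  have hsum : Summable fun k => zetaSummand k s :=
    Summable.of_norm_bounded ((summable_nat_add_one_rpow hs0).mul_left (‖1 - s‖ * ‖s‖))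
      fun k => norm_zetaSummand_le k hs0
  have hs1 : s ≠ 1 := by rintro rfl; simp at hs
  have h1 := hsum.hasSum.tendsto_sum_nat
  have hN : Filter.Tendsto (fun N : ℕ => (N : ℝ) + 1) Filter.atTop Filter.atTop :=
    Filter.tendsto_atTop_add_const_right _ _ tendsto_natCast_atTop_atTop
  have h2 : Filter.Tendsto (fun N : ℕ => ((N + 1 : ℝ) : ℂ) ^ (1 - s)) Filter.atTop (nhds 0) := by
    rw [tendsto_zero_iff_norm_tendsto_zero]
    have : Filter.Tendsto (fun N : ℕ => ((N : ℝ) + 1) ^ (-(s.re - 1))) Filter.atTop (nhds 0) :=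
      (tendsto_rpow_neg_atTop (by linarith : 0 < s.re - 1)).comp hN
    refine this.congr fun N => ?_
    rw [Complex.norm_cpow_eq_rpow_re_of_pos (by positivity)]
    simp
  have hz : HasSum (fun k : ℕ => ((k + 1 : ℝ) : ℂ) ^ (-s)) (riemannZeta s) := by
    have h3 : Summable fun k : ℕ => ((k + 1 : ℝ) : ℂ) ^ (-s) := by
      refine Summable.of_norm ?_
      refine (summable_nat_add_one_rpow (by linarith : 0 < s.re - 1)).congr fun k => ?_
      rw [Complex.norm_cpow_eq_rpow_re_of_pos (by positivity)]
      simp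
    convert h3.hasSum using 1
    rw [zeta_eq_tsum_one_div_nat_add_one_cpow hs]
    refine tsum_congr fun k => ?_
    rw [Complex.cpow_neg, one_div]; simp
  have h4 : Filter.Tendsto (fun N : ℕ => ∑ k ∈ Finset.range N, zetaSummand k s) Filter.atTop
      (nhds (0 - (1 - s) * riemannZeta s - s)) := by
    simp_rw [sum_zetaSummand]
    exact (h2.sub (((Filter.tendsto_add_atTop_iff_nat 1).2
      hz.tendsto_sum_nat).const_mul _)).sub_const _
  have h5 := tendsto_nhds_unique h1 h4
  convert hsum.hasSum using 1
  rw [h5, riemannZeta_eq_inv_sub_mul hs1]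
  field_simp [sub_ne_zero.2 hs1]
  ring

/-- Identity theorem: both sides are holomorphic and agree near `2`. Intersecting the half-plane
with a ball bounds `‖1 - w‖ * ‖w‖`, so one summable majorant serves the whole domain. -/
lemma tsum_zetaSummand {s : ℂ} (hs : 0 < s.re) :
    ∑' k, zetaSummand k s = riemannZeta₁ s - s := by
  set ε := min s.re 1 / 2 with hε
  have hε0 : 0 < ε := by positivity
  have hε1 : ε < s.re := by have := min_le_left s.re 1; have : 0 < min s.re 1 := by positivity
                            linarith
  have hε2 : ε < 1 := by have := min_le_right s.re 1; linarith
  set R := ‖s‖ + 3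
  set U : Set ℂ := {w | ε < w.re} ∩ Metric.ball 0 R
  have hU : IsOpen U := (isOpen_lt continuous_const Complex.continuous_re).inter Metric.isOpen_ball
  have hUc : IsPreconnected U :=
    ((convex_halfSpace_re_gt ε).inter (convex_ball 0 R)).isPreconnected
  have hsU : s ∈ U := ⟨hε1, by simp [R]⟩
  have h2U : (2 : ℂ) ∈ U := ⟨by simp; linarith, by simp [R]; linarith [norm_nonneg s]⟩
  have hd : DifferentiableOn ℂ (fun w => ∑' k, zetaSummand k w) U := by
    refine Complex.differentiableOn_tsum_of_summable_norm
      (u := fun k : ℕ => (1 + R) * R * ((k : ℝ) + 1) ^ (-ε - 1))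
      ((summable_nat_add_one_rpow hε0).mul_left _) (fun k => ?_) hU fun k w hw => ?_
    · have hk2 : ((k + 2 : ℝ) : ℂ) ≠ 0 := by norm_cast
      have hk1 : ((k + 1 : ℝ) : ℂ) ≠ 0 := by norm_cast
      unfold zetaSummand
      intro w _
      refine DifferentiableAt.differentiableWithinAt ?_
      refine (DifferentiableAt.sub ?_ ?_).sub (DifferentiableAt.mul (by fun_prop) ?_)
      · exact DifferentiableAt.const_cpow (by fun_prop) (Or.inl hk2)
      · exact DifferentiableAt.const_cpow (by fun_prop) (Or.inl hk1)
      · exact DifferentiableAt.const_cpow (by fun_prop) (Or.inl hk2)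
    · have hw1 : ε < w.re := hw.1
      have hw2 : ‖w‖ < R := by simpa using hw.2
      refine (norm_zetaSummand_le k (hε0.trans hw1)).trans ?_
      have h1 : ‖1 - w‖ ≤ 1 + R := (norm_sub_le _ _).trans (by simp; exact hw2.le)
      have h3 : ((k : ℝ) + 1) ^ (-w.re - 1) ≤ ((k : ℝ) + 1) ^ (-ε - 1) :=
        Real.rpow_le_rpow_of_exponent_le (by linarith [(Nat.cast_nonneg k : (0 : ℝ) ≤ k)])
          (by linarith)
      gcongr
  have hd2 : DifferentiableOn ℂ (fun w => riemannZeta₁ w - w) U :=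
    (differentiable_riemannZeta₁.sub differentiable_id).differentiableOn
  refine (hd.analyticOnNhd hU).eqOn_of_preconnected_of_eventuallyEq (hd2.analyticOnNhd hU) hUc h2U
    ?_ hsU
  filter_upwards [(isOpen_lt continuous_const Complex.continuous_re).mem_nhds
    (show (1 : ℝ) < (2 : ℂ).re by simp)] with w hw
  exact (hasSum_zetaSummand_of_one_lt_re hw).tsum_eq

lemma tendsto_cpow_sub_sum_cpow {s : ℂ} (hs : 0 < s.re) (hs1 : s ≠ 1) :
    Filter.Tendsto (fun N : ℕ => (N : ℂ) ^ (1 - s) / (1 - s)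
        - ∑ k ∈ Finset.range N, ((k : ℂ) + 1) ^ (-s)) Filter.atTop
      (nhds (-riemannZeta s)) := by
  have hs1' : 1 - s ≠ 0 := sub_ne_zero.2 hs1.symm
  have hs1'' : s - 1 ≠ 0 := sub_ne_zero.2 hs1
  have hsum : Summable fun k => zetaSummand k s :=
    Summable.of_norm_bounded ((summable_nat_add_one_rpow hs).mul_left (‖1 - s‖ * ‖s‖))
      fun k => norm_zetaSummand_le k hs
  have h := hsum.hasSum.tendsto_sum_nat
  rw [tsum_zetaSummand hs] at h
  rw [← Filter.tendsto_add_atTop_iff_nat 1]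
  convert (h.add_const s).div_const (1 - s) using 2 with N
  · rw [sum_zetaSummand]
    push_cast
    field_simp
    ring
  · rw [riemannZeta_eq_inv_sub_mul hs1]
    field_simp
    ring

/-! ### Real digamma and bounds from convexity of `log Γ` -/

/-- The digamma function on the positive reals, as the derivative of `log ∘ Γ`. -/
noncomputable def realDigamma (x : ℝ) : ℝ := deriv (Real.log ∘ Real.Gamma) x

lemma differentiableAt_log_Gamma {x : ℝ} (hx : 0 < x) :
    DifferentiableAt ℝ (Real.log ∘ Real.Gamma) x := by
  refine ((Real.differentiableAt_Gamma ?_).log (Real.Gamma_ne_zero ?_)) <;>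
  exact fun m => ne_of_gt (by linarith [(Nat.cast_nonneg m : (0 : ℝ) ≤ m)])

lemma log_Gamma_add_one {x : ℝ} (hx : 0 < x) :
    (Real.log ∘ Real.Gamma) (x + 1) = (Real.log ∘ Real.Gamma) x + Real.log x := by
  simp only [Function.comp_apply, Real.Gamma_add_one hx.ne',
    Real.log_mul hx.ne' (Real.Gamma_pos_of_pos hx).ne', add_comm]

lemma digamma_ofReal {x : ℝ} (hx : 0 < x) : Complex.digamma (x : ℂ) = (realDigamma x : ℂ) := by
  have hne : ∀ m : ℕ, x ≠ -m := fun m => ne_of_gt (by linarith [(Nat.cast_nonneg m : (0 : ℝ) ≤ m)])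
  have hr := Real.differentiableAt_Gamma hne
  have hc : DifferentiableAt ℂ Complex.Gamma (x : ℂ) :=
    Complex.differentiableAt_Gamma _ fun m h => hne m (by exact_mod_cast h)
  have h1 := hc.hasDerivAt.comp_ofReal
  have h2 := hr.hasDerivAt.ofReal_comp
  simp_rw [Complex.Gamma_ofReal] at h1
  rw [Complex.digamma_def, logDeriv_apply, h1.unique h2, Complex.Gamma_ofReal, realDigamma,
    Function.comp_def, deriv.log hr (Real.Gamma_pos_of_pos hx).ne', Complex.ofReal_div]

lemma realDigamma_add_one {x : ℝ} (hx : 0 < x) :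
    realDigamma (x + 1) = realDigamma x + 1 / x := by
  unfold realDigamma
  rw [← deriv_comp_add_const, one_div, ← Real.deriv_log,
    ← deriv_add (differentiableAt_log_Gamma hx) (Real.differentiableAt_log hx.ne')]
  apply Filter.EventuallyEq.deriv_eq
  filter_upwards [eventually_gt_nhds hx] with y hy using log_Gamma_add_one hy

/-- By the functional equation, the chord of the convex function `log Γ` over `[x, x+1]` has slope
`log x`, at most the derivative at the right end. The left end gives the companion bound below. -/
lemma log_le_realDigamma_add_one {x : ℝ} (hx : 0 < x) : Real.log x ≤ realDigamma (x + 1) := by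
  refine (le_of_eq ?_).trans <| Real.convexOn_log_Gamma.slope_le_deriv (Set.mem_Ioi.mpr hx)
    (Set.mem_Ioi.mpr (by linarith : 0 < x + 1)) (by linarith)
    (differentiableAt_log_Gamma <| by positivity)
  rw [slope_def_field, add_sub_cancel_left, div_one, log_Gamma_add_one hx, add_sub_cancel_left]

lemma realDigamma_le_log {x : ℝ} (hx : 0 < x) : realDigamma x ≤ Real.log x := by
  refine (Real.convexOn_log_Gamma.deriv_le_slope (Set.mem_Ioi.mpr hx)
    (Set.mem_Ioi.mpr (by linarith : 0 < x + 1)) (by linarith)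
    (differentiableAt_log_Gamma hx)).trans (le_of_eq ?_)
  rw [slope_def_field, add_sub_cancel_left, div_one, log_Gamma_add_one hx, add_sub_cancel_left]

/-- The defect `ψ(1 + u) - log u`. -/
noncomputable def digammaDefect (u : ℝ) : ℝ := realDigamma (u + 1) - Real.log u

lemma digammaDefect_nonneg {u : ℝ} (hu : 0 < u) : 0 ≤ digammaDefect u :=
  sub_nonneg.2 (log_le_realDigamma_add_one hu)

lemma digammaDefect_le_log_sub_log {u : ℝ} (hu : 0 < u) :
    digammaDefect u ≤ Real.log (u + 1) - Real.log u :=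
  sub_le_sub_right (realDigamma_le_log (by positivity)) _

lemma log_add_one_sub_log_le {u : ℝ} (hu : 0 < u) : Real.log (u + 1) - Real.log u ≤ 1 / u := by
  rw [← Real.log_div (by positivity) hu.ne']
  refine (Real.log_le_sub_one_of_pos (by positivity)).trans (le_of_eq ?_)
  field_simp
  ring

lemma digammaDefect_le {u : ℝ} (hu : 0 < u) : digammaDefect u ≤ 1 / u :=
  (digammaDefect_le_log_sub_log hu).trans (log_add_one_sub_log_le hu)

lemma digammaDefect_add_one {u : ℝ} (hu : 0 < u) :
    digammaDefect (u + 1) =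
      digammaDefect u - (Real.log (u + 1) - Real.log u) + 1 / (u + 1) := by
  unfold digammaDefect
  rw [realDigamma_add_one (by positivity : 0 < u + 1)]
  ring

lemma digammaDefect_add_nat {u : ℝ} (hu : 0 < u) (N : ℕ) :
    digammaDefect u - digammaDefect (u + N) =
      Real.log (u + N) - Real.log u - ∑ k ∈ Finset.range N, 1 / (u + (k + 1)) := by
  induction N with
  | zero => simp
  | succ N ih =>
    rw [Finset.sum_range_succ, Nat.cast_succ, ← add_assoc,
      digammaDefect_add_one (by positivity : 0 < u + N)]
    simp only [← add_assoc] at ih ⊢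
    linarith

/-- Monotonicity along integer steps is what dominated convergence needs: the truncations then lie
between `0` and the defect itself. -/
lemma digammaDefect_add_nat_le {u : ℝ} (hu : 0 < u) (N : ℕ) :
    digammaDefect (u + N) ≤ digammaDefect u := by
  induction N with
  | zero => simp
  | succ N ih =>
    have hp : 0 < u + N := by positivity
    have h := Real.one_sub_inv_le_log_of_pos (by positivity : 0 < (u + N + 1) / (u + N))
    rw [Real.log_div (by positivity) hp.ne', inv_div] at h
    have e : 1 - (u + N) / (u + N + 1) = 1 / (u + N + 1) := by field_simp; ring
    rw [Nat.cast_succ, ← add_assoc, digammaDefect_add_one hp]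
    linarith

/-! ### Size and continuity of the kernel -/

/-- The real-valued version of `digammaKernel`. -/
noncomputable def realKernel (u : ℝ) : ℝ := 1 / (2 * (1 + u)) - digammaDefect u

lemma digammaKernel_eq {u : ℝ} (hu : 0 < u) : digammaKernel u = (realKernel u : ℂ) := by
  have := digamma_ofReal (by positivity : 0 < u + 1)
  rw [Complex.ofReal_add, Complex.ofReal_one, add_comm] at this
  rw [digammaKernel, this, realKernel, digammaDefect]
  push_cast
  ring

lemma digammaKernel_eq_sub_digammaDefect {u : ℝ} (hu : 0 < u) :
    digammaKernel u = (1 / 2 : ℂ) • ((1 / (1 + u) : ℝ) : ℂ) - (digammaDefect u : ℂ) := by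
  have : (1 : ℂ) + u ≠ 0 := by exact_mod_cast (by positivity : 1 + u ≠ 0)
  rw [digammaKernel_eq hu, realKernel, smul_eq_mul]
  push_cast
  field_simp

lemma abs_realKernel_le_of_pos {u : ℝ} (hu : 0 < u) : |realKernel u| ≤ 1 / u := by
  have h1 : 0 ≤ 1 / (2 * (1 + u)) := by positivity
  have h2 : 1 / (2 * (1 + u)) ≤ 1 / u := one_div_le_one_div_of_le hu (by linarith)
  have := digammaDefect_nonneg hu
  have := digammaDefect_le hu
  rw [realKernel, abs_le]; constructor <;> linarith

/-- The logarithmic and rational parts of the difference both agree with `1/u - 1/(2u²)` up to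
errors `2/u³` and `1/u³`. The resulting `3/u³` is bounded by a difference that telescopes. -/
lemma abs_realKernel_sub_le {u : ℝ} (hu : 2 ≤ u) :
    |realKernel u - realKernel (u + 1)| ≤ 3 / u ^ 2 - 3 / (u + 1) ^ 2 := by
  have hu0 : 0 < u := by linarith
  set L := Real.log (u + 1) - Real.log u with hL
  have e : realKernel u - realKernel (u + 1) =
      1 / (2 * (1 + u)) - 1 / (2 * (2 + u)) - L + 1 / (u + 1) := by
    rw [realKernel, realKernel, digammaDefect_add_one hu0]; ring
  have hlog : |L - (1 / u - 1 / (2 * u ^ 2))| ≤ 2 / u ^ 3 := by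
    have hx : |(-(1 / u))| = 1 / u := by rw [abs_neg, abs_of_pos (by positivity)]
    have hx1 : 1 / u ≤ 1 / 2 := one_div_le_one_div_of_le (by norm_num) hu
    have h := Real.abs_log_sub_add_sum_range_le (x := -(1 / u)) (by rw [hx]; linarith) 2
    have hLe : Real.log (1 - -(1 / u)) = L := by
      rw [hL, ← Real.log_div (by positivity) hu0.ne']
      congr 1; field_simp; ring
    rw [hx, hLe] at h
    have h3 : (1 / u) ^ (2 + 1) / (1 - 1 / u) ≤ 2 / u ^ 3 := by
      rw [div_le_iff₀ (by linarith)]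
      have : 2 / u ^ 3 * (1 - 1 / u) - (1 / u) ^ (2 + 1) = 2 / u ^ 3 * (1 / 2 - 1 / u) := by
        rw [one_div_pow]; field_simp; ring
      have h4 : 0 ≤ 2 / u ^ 3 * (1 / 2 - 1 / u) := mul_nonneg (by positivity) (by linarith)
      linarith
    refine (le_of_eq ?_).trans (h.trans h3)
    congr 1
    simp [Finset.sum_range_succ]
    field_simp
    ring
  have hrat : |1 / (2 * (1 + u)) - 1 / (2 * (2 + u)) + 1 / (u + 1) - (1 / u - 1 / (2 * u ^ 2))|
      ≤ 1 / u ^ 3 := by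
    have : 1 / (2 * (1 + u)) - 1 / (2 * (2 + u)) + 1 / (u + 1) - (1 / u - 1 / (2 * u ^ 2))
        = -((u - 2) / (2 * u ^ 2 * (u + 1) * (u + 2))) := by
      field_simp; ring
    rw [this, abs_neg, abs_of_nonneg (div_nonneg (by linarith) (by positivity)),
      div_le_div_iff₀ (by positivity) (by positivity)]
    nlinarith [pow_pos hu0 2, pow_pos hu0 3, pow_pos hu0 4]
  have htel : 3 / u ^ 3 ≤ 3 / u ^ 2 - 3 / (u + 1) ^ 2 := by
    have : 3 / u ^ 2 - 3 / (u + 1) ^ 2 - 3 / u ^ 3 = 3 * (u ^ 2 - u - 1) / (u ^ 3 * (u + 1) ^ 2) := by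
      field_simp; ring
    have h0 : 0 ≤ 3 * (u ^ 2 - u - 1) / (u ^ 3 * (u + 1) ^ 2) :=
      div_nonneg (by nlinarith) (by positivity)
    linarith
  have h33 : 3 / u ^ 3 = 1 / u ^ 3 + 2 / u ^ 3 := by ring
  rw [e]
  refine le_trans ?_ (h33 ▸ htel)
  refine le_trans (le_of_eq ?_) ((abs_sub _ _).trans (add_le_add hrat hlog))
  congr 1; ring

/-- The quantity `|K(u)| - 3/u²` does not decrease under `u ↦ u + 1`, yet at `u + N` it is at most
`1/(u+N)`, which tends to `0`; hence it is nonpositive. -/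
lemma abs_realKernel_le {u : ℝ} (hu : 2 ≤ u) : |realKernel u| ≤ 3 / u ^ 2 := by
  have step : ∀ N : ℕ, |realKernel u| - 3 / u ^ 2 ≤
      |realKernel (u + N)| - 3 / (u + N) ^ 2 := by
    intro N
    induction N with
    | zero => simp
    | succ N ih =>
      have h := abs_realKernel_sub_le (u := u + N)
        (by linarith [(Nat.cast_nonneg N : (0 : ℝ) ≤ N)])
      have h2 := abs_sub_abs_le_abs_sub (realKernel (u + N)) (realKernel (u + N + 1))
      rw [Nat.cast_succ, ← add_assoc]
      linarith
  have hlim : Filter.Tendsto (fun N : ℕ => 1 / (u + (N : ℝ))) Filter.atTop (nhds 0) :=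
    Filter.Tendsto.const_div_atTop
      (Filter.tendsto_atTop_add_const_left _ _ tendsto_natCast_atTop_atTop) _
  have : |realKernel u| - 3 / u ^ 2 ≤ 0 := by
    refine ge_of_tendsto hlim (Filter.Eventually.of_forall fun N => (step N).trans ?_)
    have hp : 0 < u + N := by positivity
    have := abs_realKernel_le_of_pos hp
    have : 0 ≤ 3 / (u + N) ^ 2 := by positivity
    linarith
  linarith

lemma abs_realKernel_le_of_le_one {u : ℝ} (hu : 0 < u) (hu1 : u ≤ 1) :
    |realKernel u| ≤ 2 - Real.log u := by
  have h1 : 0 ≤ 1 / (2 * (1 + u)) := by positivity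
  have h2 : 1 / (2 * (1 + u)) ≤ 1 := by rw [div_le_one (by positivity)]; linarith
  have := digammaDefect_nonneg hu
  have := digammaDefect_le_log_sub_log hu
  have := Real.log_le_sub_one_of_pos (by positivity : 0 < u + 1)
  have := Real.log_nonpos hu.le hu1
  rw [realKernel, abs_le]; constructor <;> linarith

lemma continuousOn_digammaKernel : ContinuousOn digammaKernel (Set.Ioi 0) := by
  have hU : IsOpen {z : ℂ | 0 < z.re} := isOpen_lt continuous_const Complex.continuous_re
  have hne : ∀ z : ℂ, 0 < z.re → ∀ m : ℕ, z ≠ -m := by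
    intro z hz m h
    have := congrArg Complex.re h
    simp at this
    linarith [(Nat.cast_nonneg m : (0 : ℝ) ≤ m)]
  have hG : DifferentiableOn ℂ Complex.Gamma {z : ℂ | 0 < z.re} := fun z hz =>
    (Complex.differentiableAt_Gamma z (hne z hz)).differentiableWithinAt
  have hψ : ContinuousOn Complex.digamma {z : ℂ | 0 < z.re} := by
    have : Complex.digamma = fun z => deriv Complex.Gamma z / Complex.Gamma z := by
      ext z; rw [Complex.digamma_def, logDeriv_apply]
    rw [this]
    exact (hG.deriv hU).continuousOn.div hG.continuousOn fun z hz =>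
      Complex.Gamma_ne_zero (hne z hz)
  unfold digammaKernel
  refine (ContinuousOn.sub ?_ ?_).add ?_
  · exact Complex.continuous_ofReal.comp_continuousOn
      (Real.continuousOn_log.mono fun x hx => (ne_of_gt hx : x ≠ 0))
  · refine hψ.comp (by fun_prop) fun u hu => ?_
    have : (0 : ℝ) < u := hu
    simp; linarith
  · refine continuousOn_const.div (by fun_prop) fun u hu => ?_
    have : (0 : ℝ) < u := hu
    norm_cast
    positivity

/-! ### Mellin transforms of the elementary pieces -/

lemma image_div_one_add_Ioi :
    (fun t : ℝ => t / (1 + t)) '' Set.Ioi 0 = Set.Ioo 0 1 := by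
  ext y
  simp only [Set.mem_image, Set.mem_Ioi, Set.mem_Ioo]
  constructor
  · rintro ⟨t, ht, rfl⟩
    exact ⟨by positivity, by rw [div_lt_one (by positivity)]; linarith⟩
  · rintro ⟨h0, h1⟩
    have : 0 < 1 - y := by linarith
    exact ⟨y / (1 - y), by positivity, by field_simp; ring⟩

/-- The substitution `x = t/(1+t)` turns Euler's Beta integral `B(z, 1-z)` into this transform; the
reflection formula evaluates it. -/
lemma mellin_one_div_one_add {z : ℂ} (h0 : 0 < z.re) (h1 : z.re < 1) :
    mellin (fun t : ℝ => ((1 / (1 + t) : ℝ) : ℂ)) z = Real.pi / Complex.sin (Real.pi * z) := by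
  have hz1 : 0 < (1 - z).re := by simpa using h1
  rw [← Complex.Gamma_mul_Gamma_one_sub]
  have hb := Complex.betaIntegral_eq_Gamma_mul_div z (1 - z) h0 hz1
  rw [add_sub_cancel, Complex.Gamma_one, div_one] at hb
  rw [← hb, Complex.betaIntegral, intervalIntegral.integral_of_le zero_le_one,
    integral_Ioc_eq_integral_Ioo, ← image_div_one_add_Ioi,
    integral_image_eq_integral_abs_deriv_smul (f' := fun t => 1 / (1 + t) ^ 2) measurableSet_Ioi]
  · refine setIntegral_congr_fun measurableSet_Ioi fun t ht => ?_
    have ht0 : (0 : ℝ) < t := ht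
    have hp : 0 < 1 + t := by positivity
    have hpc : ((1 + t : ℝ) : ℂ) ≠ 0 := by exact_mod_cast hp.ne'
    have e : (1 : ℂ) - ((t / (1 + t) : ℝ) : ℂ) = ((1 : ℝ) / (1 + t : ℝ) : ℂ) := by
      rw [← Complex.ofReal_div, ← Complex.ofReal_one, ← Complex.ofReal_sub]
      congr 1; field_simp; ring
    simp only [smul_eq_mul, Complex.real_smul]
    rw [e, Complex.div_cpow_ofReal_nonneg zero_le_one hp.le, Complex.ofReal_div 1, Complex.ofReal_div t,
      Complex.div_cpow_ofReal_nonneg ht0.le hp.le, Complex.ofReal_one, Complex.one_cpow,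
      abs_of_pos (by positivity), show 1 - z - 1 = -((z - 1) + 1) by ring]
    have h2 : ((1 + t : ℝ) : ℂ) ^ (-((z - 1) + 1)) =
        (((1 + t : ℝ) : ℂ) ^ (z - 1) * ((1 + t : ℝ) : ℂ))⁻¹ := by
      rw [Complex.cpow_neg,
        Complex.cpow_add _ _ hpc, Complex.cpow_one]
    have h3 : ((1 + t : ℝ) : ℂ) ^ (z - 1) ≠ 0 := fun h =>
      hpc ((Complex.cpow_eq_zero_iff _ _).1 h).1
    rw [h2]
    push_cast at h3 hpc ⊢
    field_simp
  · intro t ht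
    have ht0 : (0 : ℝ) < t := ht
    have hp : 1 + t ≠ 0 := by positivity
    have := (hasDerivAt_id t).div ((hasDerivAt_id t).const_add 1) hp
    refine (this.congr_deriv ?_).hasDerivWithinAt
    simp
  · intro a ha b hb h
    have ha0 : (0 : ℝ) < a := ha
    have hb0 : (0 : ℝ) < b := hb
    simp only at h
    rw [div_eq_div_iff (by positivity) (by positivity)] at h
    linarith

lemma continuousOn_one_div_one_add :
    ContinuousOn (fun t : ℝ => ((1 / (1 + t) : ℝ) : ℂ)) (Set.Ioi 0) := by
  refine Complex.continuous_ofReal.comp_continuousOn (continuousOn_const.div (by fun_prop) ?_)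
  intro t ht
  have ht0 : (0 : ℝ) < t := ht
  positivity

lemma mellinConvergent_one_div_one_add {z : ℂ} (h0 : 0 < z.re) (h1 : z.re < 1) :
    MellinConvergent (fun t : ℝ => ((1 / (1 + t) : ℝ) : ℂ)) z := by
  refine mellinConvergent_of_isBigO_rpow (a := 1) (b := 0)
    (continuousOn_one_div_one_add.locallyIntegrableOn measurableSet_Ioi) ?_ h1 ?_ h0
  · refine Asymptotics.IsBigO.of_bound 1 ?_
    filter_upwards [Filter.eventually_gt_atTop 0] with t ht
    rw [Complex.norm_real, Real.norm_of_nonneg (by positivity), Real.rpow_neg_one, one_mul,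
      Real.norm_of_nonneg (by positivity), ← one_div]
    exact one_div_le_one_div_of_le ht (by linarith)
  · refine Asymptotics.IsBigO.of_bound 1 ?_
    filter_upwards [self_mem_nhdsWithin] with t (ht : 0 < t)
    rw [Complex.norm_real, Real.norm_of_nonneg (by positivity), neg_zero, Real.rpow_zero,
      norm_one, mul_one, div_le_one (by positivity)]
    linarith

lemma hasMellin_one_div_add {z : ℂ} (h0 : 0 < z.re) (h1 : z.re < 1) {a : ℝ} (ha : 0 < a) :
    HasMellin (fun t : ℝ => ((1 / (t + a) : ℝ) : ℂ)) z
      ((a : ℂ) ^ (z - 1) * (Real.pi / Complex.sin (Real.pi * z))) := by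
  have hac : (a : ℂ) ≠ 0 := by exact_mod_cast ha.ne'
  have e : Set.EqOn (fun t : ℝ => ((1 / (t + a) : ℝ) : ℂ))
      (fun t : ℝ => (a : ℂ)⁻¹ • ((1 / (1 + a⁻¹ * t) : ℝ) : ℂ)) (Set.Ioi 0) := by
    intro t ht
    have ht0 : (0 : ℝ) < t := ht
    simp only [smul_eq_mul]
    rw [← Complex.ofReal_inv, ← Complex.ofReal_mul]
    congr 1
    field_simp
    ring
  have hc := ((MellinConvergent.comp_mul_left (inv_pos.2 ha)).2
    (mellinConvergent_one_div_one_add h0 h1)).const_smul (a : ℂ)⁻¹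
  constructor
  · refine hc.congr_fun (fun t ht => ?_) measurableSet_Ioi
    simp only [e ht]
  · have : mellin (fun t : ℝ => ((1 / (t + a) : ℝ) : ℂ)) z =
        mellin (fun t : ℝ => (a : ℂ)⁻¹ • ((1 / (1 + a⁻¹ * t) : ℝ) : ℂ)) z :=
      setIntegral_congr_fun measurableSet_Ioi fun t ht => by simp only [e ht]
    rw [this, mellin_const_smul, mellin_comp_mul_left (fun t : ℝ => ((1 / (1 + t) : ℝ) : ℂ)) z
      (inv_pos.2 ha), mellin_one_div_one_add h0 h1, smul_eq_mul, smul_eq_mul, Complex.ofReal_inv,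
      Complex.cpow_sub _ _ hac, Complex.cpow_one, Complex.inv_cpow, Complex.cpow_neg, inv_inv]
    · ring
    · rw [Complex.arg_ofReal_of_nonneg ha.le]; exact Real.pi_pos.ne

lemma log_one_add_one_div_isBigO_nhdsGT_zero {b : ℝ} (hb : 0 < b) :
    (fun t : ℝ => ((Real.log (t + 1) - Real.log t : ℝ) : ℂ)) =O[nhdsWithin 0 (Set.Ioi 0)]
      fun t => t ^ (-b) := by
  have h1 : (fun t : ℝ => Real.log (t + 1)) =O[nhdsWithin 0 (Set.Ioi 0)] fun t : ℝ => t ^ (-b) := by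
    refine Asymptotics.IsBigO.of_bound 1 ?_
    filter_upwards [Ioo_mem_nhdsGT (zero_lt_one' ℝ)] with t ht
    have := Real.log_le_sub_one_of_pos (by linarith [ht.1] : 0 < t + 1)
    rw [Real.norm_of_nonneg (Real.log_nonneg (by linarith [ht.1])),
      Real.norm_of_nonneg (Real.rpow_nonneg ht.1.le _), one_mul]
    have := Real.one_le_rpow_of_pos_of_le_one_of_nonpos ht.1 ht.2.le (by linarith : -b ≤ 0)
    linarith [ht.2]
  rw [← Asymptotics.isBigO_norm_left]
  simp_rw [Complex.norm_real]
  rw [Asymptotics.isBigO_norm_left]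
  exact h1.sub (isLittleO_log_rpow_nhdsGT_zero (by linarith)).isBigO

lemma log_one_add_one_div_isBigO_atTop :
    (fun t : ℝ => ((Real.log (t + 1) - Real.log t : ℝ) : ℂ)) =O[Filter.atTop]
      fun t => t ^ (-1 : ℝ) := by
  refine Asymptotics.IsBigO.of_bound 1 ?_
  filter_upwards [Filter.eventually_gt_atTop 0] with t ht
  have := log_add_one_sub_log_le ht
  have h0 : 0 ≤ Real.log (t + 1) - Real.log t :=
    sub_nonneg.2 (Real.log_le_log ht (by linarith))
  rw [Complex.norm_real, Real.norm_of_nonneg h0, Real.rpow_neg_one,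
    Real.norm_of_nonneg (by positivity), one_mul, ← one_div]
  exact this

lemma mellinConvergent_log_one_add_one_div {z : ℂ} (h0 : 0 < z.re) (h1 : z.re < 1) :
    MellinConvergent (fun t : ℝ => ((Real.log (t + 1) - Real.log t : ℝ) : ℂ)) z := by
  refine mellinConvergent_of_isBigO_rpow (a := 1) (b := z.re / 2) ?_
    log_one_add_one_div_isBigO_atTop h1
    (log_one_add_one_div_isBigO_nhdsGT_zero (by linarith)) (by linarith)
  refine ContinuousOn.locallyIntegrableOn ?_ measurableSet_Ioi
  refine Complex.continuous_ofReal.comp_continuousOn (ContinuousOn.sub ?_ ?_)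
  · refine ContinuousOn.log (by fun_prop) fun t ht => ?_
    have ht0 : (0 : ℝ) < t := ht
    positivity
  · exact Real.continuousOn_log.mono fun x hx => (ne_of_gt hx : x ≠ 0)

lemma norm_cpow_div_isBigO (z : ℂ) (l : Filter ℝ) (hl : Set.Ioi 0 ∈ l) :
    (fun t : ℝ => (t : ℂ) ^ z / z) =O[l] fun t => t ^ z.re := by
  refine Asymptotics.IsBigO.of_bound ‖z‖⁻¹ ?_
  filter_upwards [hl] with t (ht : 0 < t)
  rw [norm_div, Complex.norm_cpow_eq_rpow_re_of_pos ht,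
    Real.norm_of_nonneg (Real.rpow_nonneg ht.le _), div_eq_inv_mul]

lemma mellin_log_one_add_one_div {z : ℂ} (h0 : 0 < z.re) (h1 : z.re < 1) :
    mellin (fun t : ℝ => ((Real.log (t + 1) - Real.log t : ℝ) : ℂ)) z =
      z⁻¹ * (Real.pi / Complex.sin (Real.pi * z)) := by
  have hz : z ≠ 0 := by rintro rfl; simp at h0
  set L : ℝ → ℂ := fun t => ((Real.log (t + 1) - Real.log t : ℝ) : ℂ) with hL
  -- Integration by parts against `t^z/z`. Since `1/(t+1) - 1/t = -1/(t(t+1))`, what remains is the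
  -- transform of `1/(1+t)`; both boundary terms vanish for `0 < Re z < 1`.
  have key := integral_Ioi_mul_deriv_eq_deriv_mul (a := 0) (a' := (0 : ℂ)) (b' := 0)
    (u := L) (u' := fun t => ((1 / (t + 1) - t⁻¹ : ℝ) : ℂ))
    (v := fun t : ℝ => (t : ℂ) ^ z / z) (v' := fun t => (t : ℂ) ^ (z - 1)) ?_ ?_ ?_ ?_ ?_ ?_
  · rw [mellin]
    have e1 : ∫ t in Set.Ioi (0 : ℝ), (t : ℂ) ^ (z - 1) • L t
        = ∫ t in Set.Ioi (0 : ℝ), L t * (t : ℂ) ^ (z - 1) := by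
      simp_rw [smul_eq_mul, mul_comm]
    have e2 : ∫ t in Set.Ioi (0 : ℝ), ((1 / (t + 1) - t⁻¹ : ℝ) : ℂ) * ((t : ℂ) ^ z / z) =
        -(z⁻¹ * mellin (fun t : ℝ => ((1 / (1 + t) : ℝ) : ℂ)) z) := by
      rw [mellin, ← integral_const_mul, ← integral_neg]
      refine setIntegral_congr_fun measurableSet_Ioi fun t ht => ?_
      have ht0 : (0 : ℝ) < t := ht
      have htc : (t : ℂ) ≠ 0 := by exact_mod_cast ht0.ne'
      have htc1 : (t : ℂ) + 1 ≠ 0 := by exact_mod_cast (by positivity : t + 1 ≠ 0)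
      simp only [smul_eq_mul]
      rw [Complex.cpow_sub _ _ htc, Complex.cpow_one, add_comm 1 t]
      push_cast
      field_simp
      ring
    rw [e1, key, e2, mellin_one_div_one_add h0 h1]
    ring
  · intro t ht
    have ht0 : (0 : ℝ) < t := ht
    refine HasDerivAt.ofReal_comp (HasDerivAt.sub ?_ (Real.hasDerivAt_log ht0.ne'))
    exact ((hasDerivAt_id t).add_const 1).log (by simp; positivity)
  · intro t ht
    have ht0 : (0 : ℝ) < t := ht
    refine ((hasDerivAt_ofReal_cpow_const ht0.ne' hz).div_const z).congr_deriv ?_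
    field_simp
  · refine (mellinConvergent_log_one_add_one_div h0 h1).congr_fun (fun t _ => ?_) measurableSet_Ioi
    simp [hL, mul_comm]
  · refine IntegrableOn.congr_fun
      (Integrable.const_mul (mellinConvergent_one_div_one_add h0 h1) (-z⁻¹))
      (fun t ht => ?_) measurableSet_Ioi
    have ht0 : (0 : ℝ) < t := ht
    have htc : (t : ℂ) ≠ 0 := by exact_mod_cast ht0.ne'
    have htc1 : (t : ℂ) + 1 ≠ 0 := by exact_mod_cast (by positivity : t + 1 ≠ 0)
    simp only [smul_eq_mul, Pi.mul_apply]
    rw [Complex.cpow_sub _ _ htc, Complex.cpow_one, add_comm 1 t]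
    push_cast
    field_simp
    ring
  · have hO := (log_one_add_one_div_isBigO_nhdsGT_zero (by linarith : 0 < z.re / 2)).mul
      (norm_cpow_div_isBigO z (nhdsWithin 0 (Set.Ioi 0)) self_mem_nhdsWithin)
    refine hO.trans_tendsto ?_
    have : Filter.Tendsto (fun t : ℝ => t ^ (z.re / 2)) (nhdsWithin 0 (Set.Ioi 0)) (nhds 0) := by
      have h := (Real.continuousAt_rpow_const 0 (z.re / 2) (Or.inr (by linarith))).tendsto
      rw [Real.zero_rpow (by linarith)] at h
      exact h.mono_left nhdsWithin_le_nhds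
    refine this.congr' ?_
    filter_upwards [self_mem_nhdsWithin] with t (ht : 0 < t)
    rw [← Real.rpow_add ht]
    congr 1; ring
  · have hO := log_one_add_one_div_isBigO_atTop.mul
      (norm_cpow_div_isBigO z Filter.atTop (Filter.Ioi_mem_atTop 0))
    refine hO.trans_tendsto ?_
    refine (tendsto_rpow_neg_atTop (by linarith : 0 < 1 - z.re)).congr' ?_
    filter_upwards [Filter.eventually_gt_atTop 0] with t ht
    rw [← Real.rpow_add ht]
    congr 1; ring

lemma hasMellin_log_add_sub_log {z : ℂ} (h0 : 0 < z.re) (h1 : z.re < 1) {a : ℝ} (ha : 0 < a) :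
    HasMellin (fun t : ℝ => ((Real.log (t + a) - Real.log t : ℝ) : ℂ)) z
      ((a : ℂ) ^ z / z * (Real.pi / Complex.sin (Real.pi * z))) := by
  have e : Set.EqOn (fun t : ℝ => ((Real.log (t + a) - Real.log t : ℝ) : ℂ))
      (fun t : ℝ => ((Real.log (a⁻¹ * t + 1) - Real.log (a⁻¹ * t) : ℝ) : ℂ)) (Set.Ioi 0) := by
    intro t ht
    have ht0 : (0 : ℝ) < t := ht
    simp only
    rw [← Real.log_div (by positivity) ht0.ne', ← Real.log_div (by positivity) (by positivity)]
    congr 2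
    field_simp
  constructor
  · refine ((MellinConvergent.comp_mul_left (inv_pos.2 ha)).2
      (mellinConvergent_log_one_add_one_div h0 h1)).congr_fun (fun t ht => ?_) measurableSet_Ioi
    simp only [e ht]
  · have : mellin (fun t : ℝ => ((Real.log (t + a) - Real.log t : ℝ) : ℂ)) z =
        mellin (fun t : ℝ => ((Real.log (a⁻¹ * t + 1) - Real.log (a⁻¹ * t) : ℝ) : ℂ)) z :=
      setIntegral_congr_fun measurableSet_Ioi fun t ht => by simp only [e ht]
    rw [this, mellin_comp_mul_left (fun t : ℝ => ((Real.log (t + 1) - Real.log t : ℝ) : ℂ)) z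
      (inv_pos.2 ha), mellin_log_one_add_one_div h0 h1, smul_eq_mul, Complex.ofReal_inv,
      Complex.inv_cpow, Complex.cpow_neg, inv_inv]
    · ring
    · rw [Complex.arg_ofReal_of_nonneg ha.le]; exact Real.pi_pos.ne

/-! ### Holomorphy and derivatives of the kernel's Mellin transform -/

/-- The digamma kernel multiplied by a power of the logarithm. -/
noncomputable def logPowKernel (m : ℕ) (t : ℝ) : ℂ := (Real.log t : ℂ) ^ m * digammaKernel t

lemma logPowKernel_succ (m : ℕ) :
    logPowKernel (m + 1) = fun t => Real.log t • logPowKernel m t := by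
  ext t
  rw [logPowKernel, logPowKernel, Complex.real_smul]
  ring

lemma logPowKernel_zero : logPowKernel 0 = digammaKernel := by
  ext t; simp [logPowKernel]

/-- Each logarithm costs an arbitrarily small power, so the inductive step uses the exponent midway
between `a` and `2`. -/
lemma logPowKernel_isBigO_atTop (m : ℕ) {a : ℝ} (ha : a < 2) :
    logPowKernel m =O[Filter.atTop] fun t => t ^ (-a) := by
  induction m generalizing a with
  | zero =>
    rw [logPowKernel_zero]
    refine Asymptotics.IsBigO.of_bound 3 ?_
    filter_upwards [Filter.eventually_ge_atTop 2] with t ht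
    have ht0 : 0 < t := by linarith
    rw [digammaKernel_eq ht0, Complex.norm_real, Real.norm_eq_abs,
      Real.norm_of_nonneg (Real.rpow_nonneg ht0.le _)]
    refine (abs_realKernel_le ht).trans ?_
    rw [div_eq_mul_inv, ← Real.rpow_natCast, ← Real.rpow_neg ht0.le]
    gcongr
    · linarith
    · push_cast; exact ha.le
  | succ m ih =>
    rw [logPowKernel_succ]
    have h := (isLittleO_log_rpow_atTop (by linarith : 0 < (a + 2) / 2 - a)).isBigO.smul
      (ih (by linarith : (a + 2) / 2 < 2))
    refine h.congr' Filter.EventuallyEq.rfl ?_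
    filter_upwards [Filter.eventually_gt_atTop 0] with t ht
    rw [smul_eq_mul, ← Real.rpow_add ht]
    congr 1; ring

lemma logPowKernel_isBigO_nhdsGT_zero (m : ℕ) {b : ℝ} (hb : 0 < b) :
    logPowKernel m =O[nhdsWithin 0 (Set.Ioi 0)] fun t => t ^ (-b) := by
  induction m generalizing b with
  | zero =>
    rw [logPowKernel_zero]
    have h1 : digammaKernel =O[nhdsWithin 0 (Set.Ioi 0)] fun t => 2 - Real.log t := by
      refine Asymptotics.IsBigO.of_bound 1 ?_
      filter_upwards [Ioo_mem_nhdsGT (zero_lt_one' ℝ)] with t ht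
      rw [digammaKernel_eq ht.1, Complex.norm_real, one_mul, Real.norm_eq_abs]
      exact (abs_realKernel_le_of_le_one ht.1 ht.2.le).trans (le_abs_self _)
    refine h1.trans (Asymptotics.IsBigO.sub ?_ (isLittleO_log_rpow_nhdsGT_zero (by linarith)).isBigO)
    refine Asymptotics.IsBigO.of_bound 2 ?_
    filter_upwards [Ioo_mem_nhdsGT (zero_lt_one' ℝ)] with t ht
    have := Real.one_le_rpow_of_pos_of_le_one_of_nonpos ht.1 ht.2.le (by linarith : -b ≤ 0)
    rw [Real.norm_of_nonneg (by norm_num), Real.norm_of_nonneg (by linarith)]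
    linarith
  | succ m ih =>
    rw [logPowKernel_succ]
    have h := (isLittleO_log_rpow_nhdsGT_zero (by linarith : -(b / 2) < 0)).isBigO.smul
      (ih (by linarith : 0 < b / 2))
    refine h.congr' Filter.EventuallyEq.rfl ?_
    filter_upwards [self_mem_nhdsWithin] with t (ht : 0 < t)
    rw [smul_eq_mul, ← Real.rpow_add ht]
    congr 1; ring

lemma locallyIntegrableOn_logPowKernel (m : ℕ) :
    LocallyIntegrableOn (logPowKernel m) (Set.Ioi 0) := by
  refine ContinuousOn.locallyIntegrableOn ?_ measurableSet_Ioi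
  refine ContinuousOn.mul (ContinuousOn.pow ?_ m) continuousOn_digammaKernel
  exact Complex.continuous_ofReal.comp_continuousOn
    (Real.continuousOn_log.mono fun x hx => (ne_of_gt hx : x ≠ 0))

lemma mellinConvergent_logPowKernel (m : ℕ) {z : ℂ} (h0 : 0 < z.re) (h2 : z.re < 2) :
    MellinConvergent (logPowKernel m) z :=
  mellinConvergent_of_isBigO_rpow (a := (z.re + 2) / 2) (b := z.re / 2)
    (locallyIntegrableOn_logPowKernel m) (logPowKernel_isBigO_atTop m (by linarith)) (by linarith)
    (logPowKernel_isBigO_nhdsGT_zero m (by linarith)) (by linarith)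

lemma hasDerivAt_mellin_logPowKernel (m : ℕ) {z : ℂ} (h0 : 0 < z.re) (h2 : z.re < 2) :
    HasDerivAt (mellin (logPowKernel m)) (mellin (logPowKernel (m + 1)) z) z := by
  rw [logPowKernel_succ]
  exact (mellin_hasDerivAt_of_isBigO_rpow (a := (z.re + 2) / 2) (b := z.re / 2)
    (locallyIntegrableOn_logPowKernel m) (logPowKernel_isBigO_atTop m (by linarith)) (by linarith)
    (logPowKernel_isBigO_nhdsGT_zero m (by linarith)) (by linarith)).2

lemma isOpen_strip : IsOpen {s : ℂ | -1 < s.re ∧ s.re < 1} :=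
  (isOpen_lt continuous_const Complex.continuous_re).inter
    (isOpen_lt Complex.continuous_re continuous_const)

lemma hasDerivAt_mellin_logPowKernel_one_sub (m : ℕ) {s : ℂ} (h0 : -1 < s.re) (h1 : s.re < 1) :
    HasDerivAt (fun s => (-1) ^ m * mellin (logPowKernel m) (1 - s))
      ((-1) ^ (m + 1) * mellin (logPowKernel (m + 1)) (1 - s)) s := by
  have h := (hasDerivAt_mellin_logPowKernel m (z := 1 - s) (by simp; linarith)
    (by simp; linarith)).comp s ((hasDerivAt_id s).const_sub 1)
  refine (h.const_mul ((-1) ^ m)).congr_deriv ?_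
  ring

lemma iteratedDeriv_mellin_digammaKernel (m : ℕ) {s : ℂ} (h0 : -1 < s.re) (h1 : s.re < 1) :
    iteratedDeriv m (fun s => mellin digammaKernel (1 - s)) s =
      (-1) ^ m * mellin (logPowKernel m) (1 - s) := by
  induction m generalizing s with
  | zero => simp [logPowKernel_zero]
  | succ m ih =>
    rw [iteratedDeriv_succ]
    have : iteratedDeriv m (fun s => mellin digammaKernel (1 - s)) =ᶠ[nhds s]
        fun s => (-1) ^ m * mellin (logPowKernel m) (1 - s) := by
      filter_upwards [isOpen_strip.mem_nhds ⟨h0, h1⟩] with w hw using ih hw.1 hw.2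
    rw [this.deriv_eq, (hasDerivAt_mellin_logPowKernel_one_sub m h0 h1).deriv]

lemma differentiableOn_mellin_digammaKernel :
    DifferentiableOn ℂ (fun s => mellin digammaKernel (1 - s)) {s : ℂ | -1 < s.re ∧ s.re < 1} := by
  intro s hs
  have := (hasDerivAt_mellin_logPowKernel_one_sub 0 hs.1 hs.2).differentiableAt
  simp only [pow_zero, one_mul, logPowKernel_zero] at this
  exact this.differentiableWithinAt

lemma iteratedDeriv_sin_const_mul (c : ℂ) (k : ℕ) (s : ℂ) :
    iteratedDeriv k (fun s => Complex.sin (c * s)) s =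
      c ^ k * Complex.sin (c * s + k * Real.pi / 2) := by
  induction k generalizing s with
  | zero => simp
  | succ k ih =>
    rw [iteratedDeriv_succ, funext ih]
    have h : HasDerivAt (fun s : ℂ => c * s + k * Real.pi / 2) c s := by
      simpa using ((hasDerivAt_id s).const_mul c).add_const ((k : ℂ) * Real.pi / 2)
    rw [(h.csin.const_mul (c ^ k)).deriv]
    have : c * s + ((k + 1 : ℕ) : ℂ) * Real.pi / 2 =
        (c * s + k * Real.pi / 2) + Real.pi / 2 := by push_cast; ring
    rw [this, Complex.sin_add_pi_div_two]
    ring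

/-! ### From the digamma defect to zeta -/

lemma hasMellin_sum_one_div_add {z : ℂ} (h0 : 0 < z.re) (h1 : z.re < 1) (N : ℕ) :
    HasMellin (fun t : ℝ => ((∑ k ∈ Finset.range N, 1 / (t + (k + 1)) : ℝ) : ℂ)) z
      ((∑ k ∈ Finset.range N, ((k : ℂ) + 1) ^ (z - 1)) *
        (Real.pi / Complex.sin (Real.pi * z))) := by
  induction N with
  | zero => simp [HasMellin, MellinConvergent, mellin]
  | succ N ih =>
    have hN := hasMellin_one_div_add h0 h1 (by positivity : (0 : ℝ) < (N : ℝ) + 1)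
    have h := hasMellin_add ih.1 hN.1
    rw [ih.2, hN.2] at h
    convert h using 1
    · ext t
      rw [Finset.sum_range_succ, Complex.ofReal_add]
    · rw [Finset.sum_range_succ]
      push_cast
      ring

lemma mellinConvergent_digammaDefect {z : ℂ} (h0 : 0 < z.re) (h1 : z.re < 1) :
    MellinConvergent (fun t => (digammaDefect t : ℂ)) z := by
  have hK := mellinConvergent_logPowKernel 0 h0 (by linarith)
  rw [logPowKernel_zero] at hK
  have h := (hasMellin_sub
    ((mellinConvergent_one_div_one_add h0 h1).const_smul (1 / 2 : ℂ)) hK).1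
  refine h.congr_fun (fun t ht => ?_) measurableSet_Ioi
  simp only [digammaKernel_eq_sub_digammaDefect ht, sub_sub_cancel]

lemma mellin_digammaDefect {z : ℂ} (h0 : 0 < z.re) (h1 : z.re < 1) :
    mellin (fun t => (digammaDefect t : ℂ)) z =
      -riemannZeta (1 - z) * (Real.pi / Complex.sin (Real.pi * z)) := by
  have hz : z ≠ 0 := by rintro rfl; simp at h0
  have hzeta := (tendsto_cpow_sub_sum_cpow (s := 1 - z) (by simpa using h1)
    (by simpa using hz)).mul_const ((Real.pi : ℂ) / Complex.sin (Real.pi * z))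
  -- The index starts at `1` because the transform of `log(t+a) - log t` is available only for `a >
  -- 0`.
  rw [← Filter.tendsto_add_atTop_iff_nat 1] at hzeta
  set S : ℕ → ℝ → ℂ := fun N t => ((digammaDefect t - digammaDefect (t + N) : ℝ) : ℂ) with hS
  have hmel : ∀ N : ℕ, HasMellin (S (N + 1)) z
      ((((N + 1 : ℕ) : ℂ) ^ (1 - (1 - z)) / (1 - (1 - z))
        - ∑ k ∈ Finset.range (N + 1), ((k : ℂ) + 1) ^ (-(1 - z))) *
        (Real.pi / Complex.sin (Real.pi * z))) := by
    intro N
    have hl := hasMellin_log_add_sub_log h0 h1 (by positivity : (0 : ℝ) < ((N + 1 : ℕ) : ℝ))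
    have hs := hasMellin_sum_one_div_add h0 h1 (N + 1)
    have h := hasMellin_sub hl.1 hs.1
    rw [hl.2, hs.2] at h
    have e : ∀ t ∈ Set.Ioi (0 : ℝ), S (N + 1) t =
        ((Real.log (t + ((N + 1 : ℕ) : ℝ)) - Real.log t : ℝ) : ℂ) -
          ((∑ k ∈ Finset.range (N + 1), 1 / (t + (k + 1)) : ℝ) : ℂ) := by
      intro t ht
      rw [hS]
      simp only
      rw [digammaDefect_add_nat ht, Complex.ofReal_sub]
    constructor
    · refine h.1.congr_fun (fun t ht => ?_) measurableSet_Ioi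
      simp only [e t ht]
    · rw [show 1 - (1 - z) = z by ring, show -(1 - z) = z - 1 by ring, sub_mul]
      rw [← Complex.ofReal_natCast, ← h.2]
      exact setIntegral_congr_fun measurableSet_Ioi fun t ht => by simp only [e t ht]
  refine tendsto_nhds_unique (f := fun N : ℕ => mellin (S (N + 1)) z) ?_
    (hzeta.congr fun N => (hmel N).2.symm)
  unfold mellin
  refine tendsto_integral_of_dominated_convergence
    (fun t => ‖(t : ℂ) ^ (z - 1) • (digammaDefect t : ℂ)‖)
    (fun N => (hmel N).1.aestronglyMeasurable) (mellinConvergent_digammaDefect h0 h1).norm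
    (fun N => ?_) ?_
  · filter_upwards [ae_restrict_mem measurableSet_Ioi] with t (ht : 0 < t)
    rw [norm_smul, norm_smul, hS]
    gcongr
    have hN : 0 < t + ((N + 1 : ℕ) : ℝ) := by positivity
    have h3 := digammaDefect_nonneg hN
    have h4 : 0 ≤ digammaDefect t - digammaDefect (t + ((N + 1 : ℕ) : ℝ)) :=
      sub_nonneg.2 (digammaDefect_add_nat_le ht _)
    rw [Complex.norm_real, Complex.norm_real, Real.norm_of_nonneg h4,
      Real.norm_of_nonneg (digammaDefect_nonneg ht)]
    linarith
  · filter_upwards [ae_restrict_mem measurableSet_Ioi] with t (ht : 0 < t)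
    refine Filter.Tendsto.const_smul ?_ _
    refine (Complex.continuous_ofReal.tendsto _).comp ?_
    have hlim : Filter.Tendsto (fun N : ℕ => digammaDefect (t + ((N + 1 : ℕ) : ℝ)))
        Filter.atTop (nhds 0) := by
      refine squeeze_zero (fun N => digammaDefect_nonneg (by positivity))
        (fun N => digammaDefect_le (by positivity)) ?_
      refine Filter.Tendsto.const_div_atTop (Filter.tendsto_atTop_add_const_left _ _ ?_) _
      exact tendsto_natCast_atTop_atTop.comp (Filter.tendsto_add_atTop_nat 1)
    simpa using hlim.const_sub (digammaDefect t)

lemma mellin_digammaKernel {s : ℂ} (h0 : 0 < s.re) (h1 : s.re < 1) :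
    mellin digammaKernel (1 - s) =
      (riemannZeta s + 1 / 2) * (Real.pi / Complex.sin (Real.pi * s)) := by
  have hz0 : 0 < (1 - s).re := by simpa using h1
  have hz1 : (1 - s).re < 1 := by simpa using h0
  have hsin : Complex.sin (Real.pi * (1 - s)) = Complex.sin (Real.pi * s) := by
    rw [mul_sub, mul_one, Complex.sin_pi_sub]
  have h := (hasMellin_sub ((mellinConvergent_one_div_one_add hz0 hz1).const_smul (1 / 2 : ℂ))
    (mellinConvergent_digammaDefect hz0 hz1)).2
  rw [mellin_const_smul, mellin_one_div_one_add hz0 hz1, mellin_digammaDefect hz0 hz1, hsin,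
    sub_sub_cancel, smul_eq_mul] at h
  calc mellin digammaKernel (1 - s) = _ :=
        setIntegral_congr_fun measurableSet_Ioi fun t ht => ?_
    _ = _ := h
    _ = _ := by ring
  simp only [digammaKernel_eq_sub_digammaDefect ht]

/-- With the sine multiplied across, both sides are holomorphic on the whole strip, including at `s
= 0`, so agreement near `1/2` suffices. -/
lemma riemannZeta_eq_mellin_digammaKernel {s : ℂ} (h0 : -1 < s.re) (h1 : s.re < 1) :
    riemannZeta s =
      -(1 / 2) + 1 / Real.pi * (Complex.sin (Real.pi * s) * mellin digammaKernel (1 - s)) := by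
  have hne : ∀ w ∈ {s : ℂ | -1 < s.re ∧ s.re < 1}, w ≠ 1 := by
    rintro w hw rfl
    simp at hw
  have hζ : DifferentiableOn ℂ riemannZeta {s : ℂ | -1 < s.re ∧ s.re < 1} := fun w hw =>
    (differentiableAt_riemannZeta (hne w hw)).differentiableWithinAt
  have hF : DifferentiableOn ℂ (fun s => -(1 / 2) + 1 / (Real.pi : ℂ) *
      (Complex.sin (Real.pi * s) * mellin digammaKernel (1 - s)))
      {s : ℂ | -1 < s.re ∧ s.re < 1} := by
    have := differentiableOn_mellin_digammaKernel
    have h2 : DifferentiableOn ℂ (fun s : ℂ => Complex.sin (Real.pi * s))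
      {s : ℂ | -1 < s.re ∧ s.re < 1} := by fun_prop
    exact ((h2.mul this).const_mul _).const_add _
  have hconv : IsPreconnected {s : ℂ | -1 < s.re ∧ s.re < 1} :=
    ((convex_halfSpace_re_gt (-1)).inter (convex_halfSpace_re_lt 1)).isPreconnected
  refine (hζ.analyticOnNhd isOpen_strip).eqOn_of_preconnected_of_eventuallyEq
    (hF.analyticOnNhd isOpen_strip) hconv (z₀ := ((1 / 2 : ℝ) : ℂ))
    ⟨by rw [Complex.ofReal_re]; norm_num, by rw [Complex.ofReal_re]; norm_num⟩ ?_ ⟨h0, h1⟩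
  have hU : IsOpen {s : ℂ | 0 < s.re ∧ s.re < 1} :=
    (isOpen_lt continuous_const Complex.continuous_re).inter
      (isOpen_lt Complex.continuous_re continuous_const)
  filter_upwards [hU.mem_nhds (show ((1 / 2 : ℝ) : ℂ) ∈ {s : ℂ | 0 < s.re ∧ s.re < 1} from
    ⟨by rw [Complex.ofReal_re]; norm_num, by rw [Complex.ofReal_re]; norm_num⟩)] with w hw
  rw [mellin_digammaKernel hw.1 hw.2]
  have hsin : Complex.sin (Real.pi * w) ≠ 0 := by
    refine Complex.sin_ne_zero_iff.2 fun k hk => ?_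
    rw [mul_comm, mul_left_inj' (by exact_mod_cast Real.pi_ne_zero)] at hk
    have hw0 := hw.1
    have hw1 := hw.2
    simp only [hk, Complex.intCast_re] at hw0 hw1
    norm_cast at hw0 hw1
    omega
  have hpi : (Real.pi : ℂ) ≠ 0 := by exact_mod_cast Real.pi_ne_zero
  field_simp
  ring

/-! ### Leibniz rule and the final formulas -/

lemma iteratedDeriv_riemannZeta_eq_sum_mellin {n : ℕ} (hn : 1 ≤ n) {s : ℂ} (h0 : -1 < s.re)
    (h1 : s.re < 1) :
    iteratedDeriv n riemannZeta s =
      1 / (Real.pi : ℂ) * ∑ k ∈ Finset.range (n + 1),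
        (n.choose k : ℂ) * (Real.pi : ℂ) ^ k *
          Complex.sin ((Real.pi : ℂ) * s + (k : ℂ) * (Real.pi : ℂ) / 2) *
          ((-1) ^ (n - k) * mellin (logPowKernel (n - k)) (1 - s)) := by
  have he : riemannZeta =ᶠ[nhds s] fun s =>
      -(1 / 2) + 1 / (Real.pi : ℂ) *
        (Complex.sin (Real.pi * s) * mellin digammaKernel (1 - s)) := by
    filter_upwards [isOpen_strip.mem_nhds ⟨h0, h1⟩] with w hw using
      riemannZeta_eq_mellin_digammaKernel hw.1 hw.2
  have hF : ContDiffAt ℂ n (fun s => mellin digammaKernel (1 - s)) s :=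
    (differentiableOn_mellin_digammaKernel.analyticOnNhd isOpen_strip s ⟨h0, h1⟩).contDiffAt
  have hsin : ContDiffAt ℂ n (fun s : ℂ => Complex.sin (Real.pi * s)) s := by fun_prop
  rw [he.iteratedDeriv_eq, iteratedDeriv_const_add (by omega), iteratedDeriv_const_mul_field,
    iteratedDeriv_fun_mul hsin hF]
  congr 1
  refine Finset.sum_congr rfl fun k _ => ?_
  rw [iteratedDeriv_sin_const_mul, iteratedDeriv_mellin_digammaKernel _ h0 h1]
  ring

lemma digammaIntegrand_eq (m : ℕ) (s : ℂ) (u : ℝ) :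
    digammaIntegrand m s u = (-1) ^ m * ((u : ℂ) ^ (1 - s - 1) • logPowKernel m u) := by
  rw [digammaIntegrand, logPowKernel, show 1 - s - 1 = -s by ring, Complex.cpow_neg, smul_eq_mul]
  ring

lemma integrableOn_digammaIntegrand (m : ℕ) {s : ℂ} (h0 : -1 < s.re) (h1 : s.re < 1) :
    IntegrableOn (fun u : ℝ => digammaIntegrand m s u) (Set.Ioi 0) volume := by
  have h : IntegrableOn _ (Set.Ioi (0 : ℝ)) volume :=
    mellinConvergent_logPowKernel m (z := 1 - s) (by simp; linarith) (by simp; linarith)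
  refine IntegrableOn.congr_fun (Integrable.const_mul h ((-1) ^ m)) (fun u hu => ?_)
    measurableSet_Ioi
  exact (digammaIntegrand_eq m s u).symm

lemma integral_digammaIntegrand (m : ℕ) (s : ℂ) :
    ∫ u in Set.Ioi (0 : ℝ), digammaIntegrand m s u =
      (-1) ^ m * mellin (logPowKernel m) (1 - s) := by
  rw [mellin, ← integral_const_mul]
  exact setIntegral_congr_fun measurableSet_Ioi fun u _ => digammaIntegrand_eq m s u

lemma digammaIntegrand_zero_right (m : ℕ) (u : ℝ) :
    digammaIntegrand m 0 u = digammaKernel u * ((-1) ^ m * (Real.log u : ℂ) ^ m) := by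
  rw [digammaIntegrand, Complex.cpow_zero, div_one]

lemma iteratedDeriv_riemannZeta_eq_sum {n : ℕ} (hn : 1 ≤ n) {s : ℂ} (h0 : -1 < s.re)
    (h1 : s.re < 1) :
    iteratedDeriv n riemannZeta s =
      1 / (Real.pi : ℂ) * ∑ k ∈ Finset.range (n + 1),
        (n.choose k : ℂ) * (Real.pi : ℂ) ^ k *
          Complex.sin ((Real.pi : ℂ) * s + (k : ℂ) * (Real.pi : ℂ) / 2) *
          ∫ u in Set.Ioi (0 : ℝ), digammaIntegrand (n - k) s u := by
  simp_rw [integral_digammaIntegrand]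
  exact iteratedDeriv_riemannZeta_eq_sum_mellin hn h0 h1

theorem mainTheorem3 :
    (∀ n : ℕ, 1 ≤ n → ∀ s : ℂ, 0 < s.re → s.re < 1 →
      (∀ k ∈ Finset.range (n + 1),
        IntegrableOn (fun u : ℝ => digammaIntegrand (n - k) s u) (Set.Ioi 0) volume) ∧
      iteratedDeriv n riemannZeta s =
        1 / (Real.pi : ℂ) * ∑ k ∈ Finset.range (n + 1),
          (n.choose k : ℂ) * (Real.pi : ℂ) ^ k *
            Complex.sin ((Real.pi : ℂ) * s + (k : ℂ) * (Real.pi : ℂ) / 2) *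
            ∫ u in Set.Ioi (0 : ℝ), digammaIntegrand (n - k) s u) ∧
    (∀ n : ℕ, 1 ≤ n →
      (∀ k ∈ Finset.range (n + 1),
        IntegrableOn (fun u : ℝ =>
          digammaKernel u * ((-1) ^ (n - k) * (Real.log u : ℂ) ^ (n - k)))
          (Set.Ioi 0) volume) ∧
      iteratedDeriv n riemannZeta 0 =
        1 / (Real.pi : ℂ) * ∑ k ∈ Finset.range (n + 1),
          (n.choose k : ℂ) * (Real.pi : ℂ) ^ k *
            Complex.sin ((k : ℂ) * (Real.pi : ℂ) / 2) *
            ∫ u in Set.Ioi (0 : ℝ),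
              digammaKernel u * ((-1) ^ (n - k) * (Real.log u : ℂ) ^ (n - k))) ∧
    (IntegrableOn (fun u : ℝ =>
        (Complex.digamma (1 + (u : ℂ)) - (Real.log u : ℂ) - 1 / (2 * (1 + (u : ℂ)))) *
          (Real.log u : ℂ)) (Set.Ioi 0) volume ∧
      iteratedDeriv 2 riemannZeta 0 =
        2 * ∫ u in Set.Ioi (0 : ℝ),
          (Complex.digamma (1 + (u : ℂ)) - (Real.log u : ℂ) - 1 / (2 * (1 + (u : ℂ)))) *
            (Real.log u : ℂ)) := by
  have hz0 : -1 < (0 : ℂ).re := by simp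
  have hz1 : (0 : ℂ).re < 1 := by simp
  have hint (m : ℕ) : IntegrableOn (fun u : ℝ =>
      digammaKernel u * ((-1) ^ m * (Real.log u : ℂ) ^ m)) (Set.Ioi 0) volume := by
    simpa only [digammaIntegrand_zero_right] using integrableOn_digammaIntegrand m hz0 hz1
  have hzero (n : ℕ) (hn : 1 ≤ n) := iteratedDeriv_riemannZeta_eq_sum hn hz0 hz1
  simp only [digammaIntegrand_zero_right, mul_zero, zero_add] at hzero
  refine ⟨fun n hn s h0 h1 => ⟨fun k _ => integrableOn_digammaIntegrand _ (by linarith) h1,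
    iteratedDeriv_riemannZeta_eq_sum hn (by linarith) h1⟩,
    fun n hn => ⟨fun k _ => hint _, hzero n hn⟩, ?_⟩
  have e (u : ℝ) : (Complex.digamma (1 + (u : ℂ)) - (Real.log u : ℂ) - 1 / (2 * (1 + (u : ℂ)))) *
      (Real.log u : ℂ) = digammaKernel u * ((-1) ^ 1 * (Real.log u : ℂ) ^ 1) := by
    rw [digammaKernel]; ring
  have hpi : (Real.pi : ℂ) ≠ 0 := by exact_mod_cast Real.pi_ne_zero
  simp_rw [e]
  refine ⟨hint 1, ?_⟩
  -- At `s = 0` only `k = 1` survives, since `sin 0 = sin π = 0`; its coefficient is `2π/π = 2`.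
  rw [hzero 2 (by norm_num), Finset.sum_range_succ, Finset.sum_range_succ, Finset.sum_range_succ,
    Finset.sum_range_zero]
  have hs2 : Complex.sin (((2 : ℕ) : ℂ) * Real.pi / 2) = 0 := by
    rw [Nat.cast_ofNat, mul_div_cancel_left₀ _ two_ne_zero, Complex.sin_pi]
  have hs1 : Complex.sin (((1 : ℕ) : ℂ) * Real.pi / 2) = 1 := by
    rw [Nat.cast_one, one_mul, Complex.sin_pi_div_two]
  have hs0 : Complex.sin (((0 : ℕ) : ℂ) * Real.pi / 2) = 0 := by simp
  rw [hs0, hs1, hs2]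
  norm_num
  field_simp
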